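/- Let $\mathcal{A}$ be a finite set with the discrete topology, let $\sigma\colon\mathcal{A}^{\mathbb{Z}}\to\mathcal{A}^{\mathbb{Z}}$, $(\sigma x)_i=x_{i+1}$, be the left shift, and let $X\subset\mathcal{A}^{\mathbb{Z}}$ be a subshift, that is, a closed set (for the product topology) with $\sigma X=X$. Let $P_X(n)$ be the number of words $w\in\mathcal{A}^n$ such that $x_i=w_i$ for all $0\le i<n$, for some $x\in X$. Let $\mathrm{Aut}(X)$ be the group of all homeomorphisms of $X$ that commute with $\sigma|_X$. Call $x\in X$ aperiodic if there is no integer $p>0$ with $\sigma^p x=x$. Suppose that the aperiodic points of $X$ are dense in $X$ and that $$P_X(n)=o\!\left(\frac{n^2}{\log^2 n}\right)\qquad(n\to\infty).$$ Then $\mathrm{Aut}(X)$ is amenable as a countable discrete group: $\mathrm{Aut}(X)$ is countable and there is a sequence $(F_k)_{k\in\mathbb{N}}$ of finite subsets of $\mathrm{Aut}(X)$ such that every $g\in\mathrm{Aut}(X)$ belongs to all but finitely many of the sets $F_k$, and $$\lim_{k\to\infty}\frac{|F_k\,\triangle\,gF_k|}{|F_k|}=0\qquad\text{for every } g\in\mathrm{Aut}(X).$$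 -/

import Mathlib

namespace SubshiftAut

open SymbolicDynamics.FullShift

section Subshifts

variable {A : Type*} [TopologicalSpace A]

/-- The points of the two-sided subshift `X`, with the subspace topology of `A ^ ℤ`. -/
abbrev Points (X : Subshift A ℤ) : Type _ := X.carrier

/-- The left shift `(σ x) i = x (i + 1)` as a homeomorphism of the subshift `X`. -/
def shiftHomeo (X : Subshift A ℤ) : Points X ≃ₜ Points X where
  toFun x := ⟨shift 1 x.1, X.mapsTo 1 x.2⟩
  invFun x := ⟨shift (-1) x.1, X.mapsTo (-1) x.2⟩
  left_inv x := by ext i; simp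
  right_inv x := by ext i; simp
  continuous_toFun := by fun_prop
  continuous_invFun := by fun_prop

/-- `Aut X`: the centralizer of the shift in the group of homeomorphisms of `X`. -/
abbrev Aut (X : Subshift A ℤ) : Subgroup (Points X ≃ₜ Points X) :=
  Subgroup.centralizer {shiftHomeo X}

/-- The words `w = (w₀, …, w_{n-1})` of length `n` whose cylinder meets `X`. -/
def language (X : Subshift A ℤ) (n : ℕ) : Set (Fin n → A) :=
  {w | ∃ x ∈ X.carrier, ∀ i : Fin n, x ((i : ℕ) : ℤ) = w i}

/-- The complexity function `P_X(n)`: the number of words of length `n` in the language. -/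
noncomputable def complexity (X : Subshift A ℤ) (n : ℕ) : ℕ :=
  (language X n).ncard

/-- `x` is aperiodic: there is no `p > 0` with `σ ^ p x = x`. -/
def IsAperiodic (x : ℤ → A) : Prop :=
  ∀ p : ℕ, 0 < p → (shift (1 : ℤ))^[p] x ≠ x

/-- The aperiodic points of `X` are dense in `X`. -/
def HasDenseAperiodicPoints (X : Subshift A ℤ) : Prop :=
  Dense {x : Points X | IsAperiodic x.1}

end Subshifts

section Amenability

open Filter Topology
open scoped Pointwise symmDiff

open scoped Classical in
/-- A sequence of finite subsets of `G` that eventually contains every element of `G` and is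
asymptotically invariant under left translations. The first condition makes all but finitely many
`F k` nonempty. -/
def IsFolnerSequence {G : Type*} [Group G] (F : ℕ → Finset G) : Prop :=
  (∀ g : G, ∀ᶠ k in atTop, g ∈ F k) ∧
  ∀ g : G, Tendsto (fun k => ((F k ∆ (g • F k)).card : ℝ) / ((F k).card : ℝ)) atTop (𝓝 0)

/-- Amenability of a countable discrete group: existence of a Følner sequence. -/
def IsAmenable (G : Type*) [Group G] : Prop :=
  Countable G ∧ ∃ F : ℕ → Finset G, IsFolnerSequence F

end Amenability

end SubshiftAut

/-!
Let `B r` be the set of automorphisms `φ` such that `φ` and `φ⁻¹` have range `r`. Since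
`B r * B s ⊆ B (r + s)`, these sets contain a Følner sequence as soon as, for every `ε > 0`,
`log |B r| ≤ ε r` holds for arbitrarily large `r`: otherwise, for some `m` and `δ > 0`,
`|B (r + m)|` would exceed `exp δ * |B r|` for all large `r`, and `log |B r|` would grow at least
linearly.

To bound `|B r|`, fix `k ≥ 4 r`. In a point of `X`, a letter that is not preceded by a right
special word of length `k` is determined by the `k` letters before it, and right special words
occur arbitrarily far to the left in an aperiodic point. Hence an element of `B r` is determined
by its action on one point for each pair of a right special word of length `k` and a letter that
can follow it, and there it only matters which word of length `k + 2 r` appears in the image. The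
number of such pairs is at most `2 (P (k + 1) - P k)`, which by averaging is at most
`P (10 r) / (2 r)` for some `k` in `[4 r, 8 r)`. Therefore
`2 r * log |B r| ≤ P (10 r) * log P (10 r)`.
-/

namespace SubshiftAut

section Growth

open Filter Topology
open scoped Finset Pointwise symmDiff

theorem exists_ge_add_le_of_frequently_le {f : ℕ → ℝ} (hf : Monotone f)
    (hsub : ∀ ε : ℝ, 0 < ε → ∃ᶠ n : ℕ in atTop, f n ≤ ε * n) (m : ℕ) {δ : ℝ} (hδ : 0 < δ) :
    ∃ n ≥ m, f (n + m) ≤ f n + δ := by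
  by_contra! hstep
  have hm : 0 < m := Nat.pos_of_ne_zero <| by
    rintro rfl
    linarith [hstep 0 le_rfl]
  have hiter (j : ℕ) : f m + j * δ ≤ f (m + j * m) := by
    induction j with
    | zero => simp
    | succ j ih =>
      have hlt := hstep (m + j * m) (Nat.le_add_right _ _)
      rw [add_assoc m, ← Nat.succ_mul] at hlt
      push_cast
      linarith
  have hlinear {n : ℕ} (hn : m ≤ n) : f m + (n / m - 2 : ℝ) * δ ≤ f n := by
    obtain ⟨l, rfl⟩ := Nat.exists_eq_add_of_le hn
    have hquot : ((m + l : ℕ) / m - 2 : ℝ) ≤ (l / m : ℕ) := by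
      have hlt : (l : ℝ) < ((l / m : ℕ) + 1) * m := by
        exact_mod_cast (Nat.lt_mul_div_succ l hm).trans_eq (mul_comm _ _)
      rw [sub_le_iff_le_add, div_le_iff₀ (by positivity)]
      push_cast
      linarith
    calc f m + ((m + l : ℕ) / m - 2 : ℝ) * δ ≤ f m + (l / m : ℕ) * δ := by gcongr
      _ ≤ f (m + l / m * m) := hiter _
      _ ≤ f (m + l) := hf (Nat.add_le_add_left (Nat.div_mul_le_self l m) m)
  have hslope : 0 < δ / (2 * m) := by positivity
  obtain ⟨n, hle, hmn, hlarge⟩ := ((hsub _ hslope).and_eventually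
    ((eventually_ge_atTop m).and ((tendsto_natCast_atTop_atTop.const_mul_atTop
      hslope).eventually_gt_atTop (2 * δ - f m)))).exists
  have hdouble : n / m * δ = 2 * (δ / (2 * m) * n) := by
    field_simp
  linarith [hlinear hmn]

theorem exists_ge_card_le_exp_mul_card {α : Type*} {B : ℕ → Finset α} (hB : Monotone B)
    (hne : ∀ n, (B n).Nonempty)
    (hsub : ∀ ε : ℝ, 0 < ε → ∃ᶠ n : ℕ in atTop, Real.log #(B n) ≤ ε * n) (m : ℕ) {δ : ℝ}
    (hδ : 0 < δ) : ∃ n ≥ m, #(B (n + m)) ≤ Real.exp δ * #(B n) := by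
  have hpos (n : ℕ) : (0 : ℝ) < #(B n) := mod_cast (hne n).card_pos
  have hlog : Monotone fun n => Real.log #(B n) := fun m n hmn =>
    Real.log_le_log (hpos m) (mod_cast Finset.card_le_card (hB hmn))
  obtain ⟨n, hmn, hn⟩ := exists_ge_add_le_of_frequently_le hlog hsub m hδ
  refine ⟨n, hmn, ?_⟩
  calc (#(B (n + m)) : ℝ) = Real.exp (Real.log #(B (n + m))) := (Real.exp_log (hpos _)).symm
    _ ≤ Real.exp (Real.log #(B n) + δ) := Real.exp_le_exp.2 hn
    _ = Real.exp δ * #(B n) := by rw [Real.exp_add, Real.exp_log (hpos n), mul_comm]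

theorem card_symmDiff_add_le {α : Type*} [DecidableEq α] {s t u : Finset α} (hs : s ⊆ u)
    (ht : t ⊆ u) : #(s ∆ t) + (#s + #t) ≤ 2 * #u := by
  have hunion : #(s ∪ t) ≤ #u := Finset.card_le_card (Finset.union_subset hs ht)
  have hsdiff : #(s ∆ t) ≤ #(s \ t) + #(t \ s) := Finset.card_union_le _ _
  have hst := Finset.card_sdiff_add_card s t
  have hts := Finset.card_sdiff_add_card t s
  rw [Finset.union_comm] at hts
  omega

theorem card_symmDiff_smul_div_card_le {G : Type*} [Group G] [DecidableEq G] {s t : Finset G}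
    {g : G} {c : ℝ} (hs : s ⊆ t) (hgs : g • s ⊆ t) (hcard : #t ≤ c * #s) (hne : s.Nonempty) :
    (#(s ∆ (g • s)) / #s : ℝ) ≤ 2 * (c - 1) := by
  have hsymm : (#(s ∆ (g • s)) + (#s + #s) : ℝ) ≤ 2 * #t := by
    have h := card_symmDiff_add_le hs hgs
    rw [Finset.card_smul_finset] at h
    exact_mod_cast h
  rw [div_le_iff₀ (mod_cast hne.card_pos)]
  linarith

section GroupFiltration

variable {G : Type*} [Group G] {B : ℕ → Finset G}

theorem monotone_of_one_mem_of_mul_mem (hone : ∀ n, 1 ∈ B n)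
    (hmul : ∀ m n, ∀ g ∈ B m, ∀ h ∈ B n, g * h ∈ B (m + n)) : Monotone B := by
  intro m n hmn g hg
  obtain ⟨l, rfl⟩ := Nat.exists_eq_add_of_le hmn
  simpa using hmul m l g hg 1 (hone l)

theorem isAmenable_of_frequently_log_card_le (hone : ∀ n, 1 ∈ B n)
    (hmul : ∀ m n, ∀ g ∈ B m, ∀ h ∈ B n, g * h ∈ B (m + n)) (hcover : ∀ g, ∃ n, g ∈ B n)
    (hsub : ∀ ε : ℝ, 0 < ε → ∃ᶠ n : ℕ in atTop, Real.log #(B n) ≤ ε * n) :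
    IsAmenable G := by
  classical
  have hmono := monotone_of_one_mem_of_mul_mem hone hmul
  have hne (n : ℕ) : (B n).Nonempty := ⟨1, hone n⟩
  choose N hN hratio using fun j : ℕ => exists_ge_card_le_exp_mul_card hmono hne hsub j
    (Nat.one_div_pos_of_nat (α := ℝ) (n := j))
  refine ⟨?_, fun j => B (N j), fun g => ?_, fun g => ?_⟩
  · refine Set.countable_univ_iff.1 <|
      (Set.countable_iUnion fun n => (B n).countable_toSet).mono fun g _ => ?_
    exact Set.mem_iUnion.2 (hcover g)
  · obtain ⟨m, hm⟩ := hcover g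
    filter_upwards [eventually_ge_atTop m] with j hj
    exact hmono (hj.trans (hN j)) hm
  · obtain ⟨m, hm⟩ := hcover g
    have hlim : Tendsto (fun j : ℕ => 2 * (Real.exp (1 / (j + 1)) - 1)) atTop (𝓝 0) := by
      simpa using ((tendsto_one_div_add_atTop_nhds_zero_nat (𝕜 := ℝ)).rexp.sub_const 1).const_mul 2
    refine squeeze_zero' (Eventually.of_forall fun j => by positivity) ?_ hlim
    filter_upwards [eventually_ge_atTop m] with j hj
    have hgB : g • B (N j) ⊆ B (N j + j) := by
      rintro _ hx
      obtain ⟨b, hb, rfl⟩ := Finset.mem_smul_finset.1 hx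
      rw [add_comm]
      exact hmul j (N j) g (hmono hj hm) b hb
    convert card_symmDiff_smul_div_card_le (hmono (Nat.le_add_right _ _)) hgB (hratio j) (hne _)

end GroupFiltration

end Growth

open Set SymbolicDynamics.FullShift

section Words

variable {A : Type*}

/-- The word of length `n` that the configuration `x` shows at the position `i`. -/
def word (x : ℤ → A) (i : ℤ) (n : ℕ) : Fin n → A := fun j => x (i + j)

theorem word_eq_word_iff {x y : ℤ → A} {i : ℤ} {n : ℕ} :
    word x i n = word y i n ↔ EqOn x y (Ico i (i + n)) := by
  refine ⟨fun h j hj => ?_, fun h => funext fun j => h ⟨by omega, by omega⟩⟩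
  obtain ⟨l, rfl⟩ := Int.le.dest hj.1
  exact congrFun h ⟨l, by have := hj.2; omega⟩

theorem word_shift (x : ℤ → A) (l i : ℤ) (n : ℕ) : word (shift l x) i n = word x (l + i) n :=
  funext fun j => congrArg x (add_assoc l i j).symm

theorem exists_infinite_forall_word_eq [Finite A] (x : ℤ → A) (i : ℤ) (k : ℕ) :
    ∃ S : Set ℕ, S.Infinite ∧ ∀ p ∈ S, ∀ q ∈ S, word x (i - p) k = word x (i - q) k := by
  obtain ⟨w, hw⟩ := Finite.exists_infinite_fiber fun q : ℕ => word x (i - q) k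
  exact ⟨_, infinite_coe_iff.1 hw, fun p hp q hq => Eq.trans hp (Eq.symm hq)⟩

theorem iterate_shift {G : Type*} [AddMonoid G] (g : G) (p : ℕ) (x : G → A) :
    (shift g)^[p] x = shift (p • g) x := by
  induction p generalizing x with
  | zero => simp
  | succ p ih => rw [Function.iterate_succ_apply, ih, succ_nsmul', shift_add]

theorem exists_forall_eqOn_Icc_imp_eq [TopologicalSpace A] [T2Space A] {β : Type*}
    [TopologicalSpace β] [DiscreteTopology β] {K : Set (ℤ → A)} (hK : IsCompact K) {g : K → β}
    (hg : Continuous g) :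
    ∃ r : ℕ, ∀ x y : K, EqOn x.1 y.1 (Icc (-r) r) → g x = g y := by
  have : CompactSpace K := isCompact_iff_compactSpace.1 hK
  let agree (r : ℕ) : Set (K × K) := {q | EqOn q.1.1 q.2.1 (Icc (-r) r)}
  have hcoord (j : ℤ) : Continuous fun x : K => x.1 j :=
    (continuous_apply j).comp continuous_subtype_val
  have hclosed (r : ℕ) : IsClosed (agree r) := by
    simp only [agree, EqOn, ofPred_forall]
    exact isClosed_biInter fun j _ =>
      isClosed_eq ((hcoord j).comp continuous_fst) ((hcoord j).comp continuous_snd)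
  have hanti : Antitone agree := fun r s hrs q hq =>
    hq.mono (Icc_subset_Icc (by omega) (by omega))
  have hdiff : IsClosed {q : K × K | g q.1 ≠ g q.2} :=
    (isClosed_discrete {b : β × β | b.1 ≠ b.2}).preimage
      ((hg.comp continuous_fst).prodMk (hg.comp continuous_snd))
  have hempty : {q : K × K | g q.1 ≠ g q.2} ∩ ⋂ r, agree r = ∅ := by
    refine eq_empty_of_forall_notMem fun q ⟨hne, hagree⟩ => hne (congrArg g ?_)
    ext j
    exact mem_iInter.1 hagree j.natAbs ⟨by omega, by omega⟩
  obtain ⟨r, hr⟩ := hdiff.isCompact.elim_directed_family_closed agree hclosed hempty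
    hanti.directed_ge
  refine ⟨r, fun x y hxy => ?_⟩
  by_contra hne
  exact eq_empty_iff_forall_notMem.1 hr (x, y) ⟨hne, hxy⟩

end Words

section Automorphisms

variable {A : Type*} [TopologicalSpace A] {X : Subshift A ℤ}

theorem coe_shiftHomeo_zpow (i : ℤ) (x : Points X) :
    ((shiftHomeo X ^ i) x).1 = shift i x.1 := by
  induction i generalizing x with
  | zero => simp
  | succ i ih => rw [shift_add, ← ih, add_comm, zpow_one_add]; rfl
  | pred i ih => rw [sub_eq_add_neg, shift_add, ← ih, add_comm, zpow_add, zpow_neg_one]; rfl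

@[simp]
theorem shiftHomeo_zpow_apply (i j : ℤ) (x : Points X) :
    ((shiftHomeo X ^ i) x).1 j = x.1 (i + j) := by
  rw [coe_shiftHomeo_zpow, shift_apply]

theorem Aut.map_shiftHomeo_zpow (φ : Aut X) (i : ℤ) (x : Points X) :
    φ.1 ((shiftHomeo X ^ i) x) = (shiftHomeo X ^ i) (φ.1 x) := by
  have hcomm : Commute φ.1 (shiftHomeo X) := (Subgroup.mem_centralizer_iff.1 φ.2 _ rfl).symm
  exact DFunLike.congr_fun (hcomm.zpow_right i).eq x

/-- The self-map `f` has range `r`: the coordinate at `0` of `f x` depends only on the coordinates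
of `x` in `[-r, r]`. For a map that commutes with the shift this says that `f` is a sliding block
code of window `[-r, r]`. -/
def HasRange (r : ℕ) (f : Points X → Points X) : Prop :=
  ∀ ⦃x y : Points X⦄, EqOn x.1 y.1 (Icc (-r) r) → (f x).1 0 = (f y).1 0

theorem HasRange.mono {r s : ℕ} {f : Points X → Points X} (hf : HasRange r f) (hrs : r ≤ s) :
    HasRange s f :=
  fun _ _ hxy => hf (hxy.mono (Icc_subset_Icc (by omega) (by omega)))

theorem HasRange.eqOn_Ico {r : ℕ} {φ : Aut X} (hφ : HasRange r φ.1) {x y : Points X} {a b : ℤ}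
    (hxy : EqOn x.1 y.1 (Ico (a - r) (b + r))) : EqOn (φ.1 x).1 (φ.1 y).1 (Ico a b) := by
  intro i ⟨hai, hib⟩
  have h : (φ.1 ((shiftHomeo X ^ i) x)).1 0 = (φ.1 ((shiftHomeo X ^ i) y)).1 0 :=
    hφ fun j ⟨hj, hj'⟩ => by
      simpa using hxy (show i + j ∈ Ico (a - r) (b + r) from ⟨by omega, by omega⟩)
  simpa [Aut.map_shiftHomeo_zpow] using h

theorem HasRange.mul {r s : ℕ} {φ ψ : Aut X} (hφ : HasRange r φ.1) (hψ : HasRange s ψ.1) :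
    HasRange (r + s) (φ * ψ).1 := fun x y hxy =>
  have hψxy : EqOn (ψ.1 x).1 (ψ.1 y).1 (Ico (-r) (r + 1)) :=
    hψ.eqOn_Ico fun j ⟨hj, hj'⟩ => hxy ⟨by push_cast; omega, by push_cast; omega⟩
  hφ fun j hj => hψxy ⟨hj.1, Int.lt_add_one_of_le hj.2⟩

theorem hasRange_one (r : ℕ) : HasRange r (1 : Aut X).1 :=
  fun _ _ hxy => hxy ⟨by omega, by omega⟩

theorem exists_hasRange [Finite A] [DiscreteTopology A] {f : Points X → Points X}
    (hf : Continuous f) : ∃ r, HasRange r f :=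
  exists_forall_eqOn_Icc_imp_eq X.isClosed.isCompact
    ((continuous_apply 0).comp (continuous_subtype_val.comp hf))

variable (X) in
/-- The automorphisms `φ` such that both `φ` and `φ⁻¹` have range `r`: the balls of a filtration
of `Aut X`, symmetric under inversion. -/
def autRange (r : ℕ) : Set (Aut X) :=
  {φ | HasRange r φ.1 ∧ HasRange r (φ⁻¹).1}

theorem autRange_mono : Monotone (autRange X) :=
  fun _ _ hrs _ hφ => ⟨hφ.1.mono hrs, hφ.2.mono hrs⟩

theorem one_mem_autRange (r : ℕ) : 1 ∈ autRange X r :=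
  ⟨hasRange_one r, inv_one (G := Aut X) ▸ hasRange_one r⟩

theorem mul_mem_autRange {r s : ℕ} {φ ψ : Aut X} (hφ : φ ∈ autRange X r)
    (hψ : ψ ∈ autRange X s) : φ * ψ ∈ autRange X (r + s) := by
  refine ⟨hφ.1.mul hψ.1, ?_⟩
  rw [mul_inv_rev, add_comm]
  exact hψ.2.mul hφ.2

theorem exists_mem_autRange [Finite A] [DiscreteTopology A] (φ : Aut X) :
    ∃ r, φ ∈ autRange X r := by
  obtain ⟨r, hr⟩ := exists_hasRange φ.1.continuous
  obtain ⟨s, hs⟩ := exists_hasRange (φ⁻¹).1.continuous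
  exact ⟨max r s, hr.mono (le_max_left r s), hs.mono (le_max_right r s)⟩

end Automorphisms

section RightSpecial

variable {A : Type*} [TopologicalSpace A] {X : Subshift A ℤ}

/-- The word of length `k` that ends just before the position `m` of `x` is right special: in some
point of `X` it is followed by a letter other than `x m`. -/
def RightSpecialBefore (k : ℕ) (x : Points X) (m : ℤ) : Prop :=
  ∃ y : Points X, EqOn y.1 x.1 (Ico (m - k) m) ∧ y.1 m ≠ x.1 m

theorem RightSpecialBefore.shift {k : ℕ} {x : Points X} {m : ℤ} (hm : RightSpecialBefore k x m)
    (i : ℤ) : RightSpecialBefore k ((shiftHomeo X ^ i) x) (m - i) := by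
  obtain ⟨y, hyx, hne⟩ := hm
  refine ⟨(shiftHomeo X ^ i) y, fun j ⟨hj, hj'⟩ => ?_, by simpa using hne⟩
  simpa using hyx (show i + j ∈ Ico (m - k) m from ⟨by omega, by omega⟩)

theorem rightSpecialBefore_shift_iff {k : ℕ} {x : Points X} {m i : ℤ} :
    RightSpecialBefore k ((shiftHomeo X ^ i) x) m ↔ RightSpecialBefore k x (i + m) := by
  refine ⟨fun h => ?_, fun h => by simpa using h.shift i⟩
  have hshift := h.shift (-i)
  rwa [← Homeomorph.mul_apply, ← zpow_add, neg_add_cancel, zpow_zero, Homeomorph.one_apply,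
    sub_neg_eq_add, add_comm] at hshift

theorem eqOn_Ico_of_forall_not_rightSpecialBefore {k : ℕ} {x y : Points X} {a b c : ℤ}
    (hca : c ≤ a - k) (hns : ∀ m ∈ Ico a b, ¬RightSpecialBefore k x m)
    (hyx : EqOn y.1 x.1 (Ico c a)) : EqOn y.1 x.1 (Ico c b) := by
  rcases le_total b a with hba | hab
  · exact hyx.mono (Ico_subset_Ico_right hba)
  induction b, hab using Int.leInduction with
  | base => exact hyx
  | succ b hab ih =>
    have hb : EqOn y.1 x.1 (Ico c b) := ih fun m hm => hns m ⟨hm.1, by have := hm.2; omega⟩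
    intro j ⟨hcj, hjb⟩
    rcases (Int.lt_add_one_iff.1 hjb).lt_or_eq with hlt | rfl
    · exact hb ⟨hcj, hlt⟩
    · by_contra hne
      exact hns j ⟨hab, hjb⟩ ⟨y, hb.mono (Ico_subset_Ico_left (by omega)), hne⟩

theorem IsAperiodic.exists_rightSpecialBefore_le [Finite A] {x : Points X} (hx : IsAperiodic x.1)
    (k : ℕ) (M : ℤ) : ∃ m ≤ M, RightSpecialBefore k x m := by
  by_contra! hns
  obtain ⟨S, hS, hword⟩ := exists_infinite_forall_word_eq x.1 (M - k) k
  -- For `Q ∈ S` the translate of `x` to the right by `Q` has no right special word before `M + Q`,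
  -- so on `[M - k, M + Q]` it agrees with the translate by any other element of `S`.
  have htranslate {p Q : ℕ} (hp : p ∈ S) (hQ : Q ∈ S) :
      EqOn (shift (-p : ℤ) x.1) (shift (-Q : ℤ) x.1) (Ico (M - k) (M + Q + 1)) := by
    rw [← coe_shiftHomeo_zpow, ← coe_shiftHomeo_zpow]
    refine eqOn_Ico_of_forall_not_rightSpecialBefore le_rfl (fun m ⟨_, hm⟩ => ?_) ?_
    · rw [rightSpecialBefore_shift_iff]
      exact hns _ (by omega)
    · have h := hword p hp Q hQ
      simp only [sub_eq_neg_add (M - k : ℤ), ← word_shift] at h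
      simpa only [coe_shiftHomeo_zpow, sub_add_cancel] using word_eq_word_iff.1 h
  have hshift {p q : ℕ} (hp : p ∈ S) (hq : q ∈ S) {j : ℤ} (hj : M ≤ j) :
      x.1 (j - p) = x.1 (j - q) := by
    obtain ⟨Q, hQ, hjQ⟩ := hS.exists_gt (j - M).toNat
    have hjmem : j ∈ Ico (M - k) (M + Q + 1) := ⟨by omega, by omega⟩
    have h := (htranslate hp hQ hjmem).trans (htranslate hq hQ hjmem).symm
    rwa [shift_apply, shift_apply, neg_add_eq_sub, neg_add_eq_sub] at h
  obtain ⟨p, hp⟩ := hS.nonempty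
  obtain ⟨q, hq, hpq⟩ := hS.exists_gt p
  refine hx (q - p) (Nat.sub_pos_of_lt hpq) ?_
  rw [iterate_shift]
  ext i
  obtain ⟨Q, hQ, hiQ⟩ := hS.exists_gt (M - i).toNat
  rw [shift_apply, nsmul_one, Nat.cast_sub hpq.le]
  calc x.1 (q - p + i) = x.1 (q - p + i + Q - Q) := by rw [add_sub_cancel_right]
    _ = x.1 (q - p + i + Q - q) := hshift hQ hq (by omega)
    _ = x.1 (i + Q - p) := by ring_nf
    _ = x.1 (i + Q - Q) := hshift hp hQ (by omega)
    _ = x.1 i := by rw [add_sub_cancel_right]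

theorem HasRange.apply_eq_self_of_forall_not_rightSpecialBefore {n k : ℕ} {θ : Aut X}
    (hθ : HasRange n θ.1) (hn : 0 < n) (hnk : 2 * n ≤ k) {x z : Points X} {m N : ℤ} (hmN : m ≤ N)
    (hns : ∀ j ∈ Ioc m N, ¬RightSpecialBefore k x j) (hzx : EqOn z.1 x.1 (Icc (m - k) m))
    (hθz : EqOn (θ.1 z).1 z.1 (Ico (m - k + n) (m + n))) :
    (θ.1 x).1 (N - n) = x.1 (N - n) := by
  have hns' {a : ℤ} (ha : m < a) : ∀ j ∈ Ico a (N + 1), ¬RightSpecialBefore k x j :=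
    fun j hj => hns j ⟨ha.trans_le hj.1, Int.lt_add_one_iff.1 hj.2⟩
  have hzx' : EqOn z.1 x.1 (Ico (m - k) (N + 1)) :=
    eqOn_Ico_of_forall_not_rightSpecialBefore (by omega) (hns' (lt_add_one m))
      fun j hj => hzx ⟨hj.1, Int.lt_add_one_iff.1 hj.2⟩
  have hθzx : EqOn (θ.1 z).1 (θ.1 x).1 (Ico (m - k + n) (N - n + 1)) :=
    hθ.eqOn_Ico (hzx'.mono (Ico_subset_Ico (by omega) (by omega)))
  have hθx {j : ℤ} (hj : m - k + n ≤ j) (hjm : j < m + n) (hjN : j ≤ N - n) :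
      (θ.1 x).1 j = x.1 j :=
    calc (θ.1 x).1 j = (θ.1 z).1 j := (hθzx ⟨hj, by omega⟩).symm
      _ = z.1 j := hθz ⟨hj, hjm⟩
      _ = x.1 j := hzx' ⟨by omega, by omega⟩
  rcases lt_or_ge (N - n) (m + n) with hlt | hge
  · exact hθx (by omega) hlt le_rfl
  · exact eqOn_Ico_of_forall_not_rightSpecialBefore (by omega) (hns' (by omega : m < m + n))
      (fun j ⟨hj, hjm⟩ => hθx hj hjm (by omega)) ⟨by omega, by omega⟩

theorem HasRange.apply_eq_self_of_isAperiodic [Finite A] {n k : ℕ} {θ : Aut X}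
    (hθ : HasRange n θ.1) (hn : 0 < n) (hnk : 2 * n ≤ k)
    (hfix : ∀ x : Points X, RightSpecialBefore k x k → ∃ z : Points X,
      EqOn z.1 x.1 (Icc 0 k) ∧ EqOn (θ.1 z).1 z.1 (Ico n (k + n)))
    {x : Points X} (hx : IsAperiodic x.1) : θ.1 x = x := by
  ext i
  obtain ⟨m, ⟨hmN, hm⟩, hmax⟩ := Int.exists_greatest_of_bdd
    (P := fun m => m ≤ i + n ∧ RightSpecialBefore k x m) ⟨i + n, fun _ h => h.1⟩
    (hx.exists_rightSpecialBefore_le k (i + n))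
  set y := (shiftHomeo X ^ (m - k)) x with hy
  obtain ⟨z, hzy, hθz⟩ := hfix y (by rwa [hy, rightSpecialBefore_shift_iff, sub_add_cancel])
  have hns : ∀ j ∈ Ioc (k : ℤ) (i + n - m + k), ¬RightSpecialBefore k y j := by
    intro j ⟨hkj, hj⟩ hspecial
    rw [hy, rightSpecialBefore_shift_iff] at hspecial
    have := hmax _ ⟨by omega, hspecial⟩
    omega
  have hθy := hθ.apply_eq_self_of_forall_not_rightSpecialBefore hn hnk (by omega) hns
    (by simpa using hzy) (by simpa using hθz)
  simp only [hy, Aut.map_shiftHomeo_zpow, shiftHomeo_zpow_apply] at hθy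
  convert hθy using 2 <;> ring

theorem HasRange.eq_one_of_fixes_rightSpecial [Finite A] [DiscreteTopology A]
    (hdense : HasDenseAperiodicPoints X) {n k : ℕ} {θ : Aut X} (hθ : HasRange n θ.1)
    (hn : 0 < n) (hnk : 2 * n ≤ k)
    (hfix : ∀ x : Points X, RightSpecialBefore k x k → ∃ z : Points X,
      EqOn z.1 x.1 (Icc 0 k) ∧ EqOn (θ.1 z).1 z.1 (Ico n (k + n))) : θ = 1 := by
  have hid : ⇑θ.1 = id := θ.1.continuous.ext_on hdense continuous_id
    fun _ hx => hθ.apply_eq_self_of_isAperiodic hn hnk hfix hx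
  exact Subtype.ext (Homeomorph.ext (congrFun hid))

end RightSpecial

section Counting

open Filter
open scoped Finset

theorem card_filter_exists_ne_add_le {α β : Type*} [DecidableEq α] [DecidableEq β]
    (s : Finset α) (f : α → β) :
    #{u ∈ s | ∃ v ∈ s, v ≠ u ∧ f v = f u} + 2 * #(s.image f) ≤ 2 * #s := by
  set t := {u ∈ s | ∃ v ∈ s, v ≠ u ∧ f v = f u}
  have hts : t ⊆ s := Finset.filter_subset _ _
  have hmaps : ∀ u ∈ s, f u ∈ s.image f := fun u hu => Finset.mem_image_of_mem f hu
  rw [Finset.card_eq_sum_card_fiberwise hmaps,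
    Finset.card_eq_sum_card_fiberwise fun u hu => hmaps u (hts hu), Finset.card_eq_sum_ones,
    Finset.mul_sum, Finset.mul_sum, ← Finset.sum_add_distrib]
  refine Finset.sum_le_sum fun b hb => ?_
  have hle : #{u ∈ t | f u = b} ≤ #{u ∈ s | f u = b} :=
    Finset.card_le_card (Finset.filter_subset_filter _ hts)
  rcases Finset.eq_empty_or_nonempty {u ∈ t | f u = b} with hempty | ⟨u, hu⟩
  · have hpos : 0 < #{u ∈ s | f u = b} := by
      obtain ⟨u, hu, rfl⟩ := Finset.mem_image.1 hb
      exact Finset.card_pos.2 ⟨u, Finset.mem_filter.2 ⟨hu, rfl⟩⟩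
    rw [hempty, Finset.card_empty]
    omega
  · obtain ⟨hut, rfl⟩ := Finset.mem_filter.1 hu
    obtain ⟨hus, v, hvs, hvu, hfvu⟩ := Finset.mem_filter.1 hut
    have htwo : 1 < #{w ∈ s | f w = f u} := Finset.one_lt_card.2
      ⟨v, Finset.mem_filter.2 ⟨hvs, hfvu⟩, u, Finset.mem_filter.2 ⟨hus, rfl⟩, hvu⟩
    omega

theorem exists_mem_Ico_nsmul_sub_le {R : Type*} [AddCommGroup R] [LinearOrder R]
    [IsOrderedAddMonoid R] (f : ℕ → R) (a : ℕ) {l : ℕ} (hl : 0 < l) :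
    ∃ k ∈ Ico a (a + l), l • (f (k + 1) - f k) ≤ f (a + l) - f a := by
  by_contra! hstep
  have hlt : l • (f (a + l) - f a) < l • (f (a + l) - f a) :=
    calc
      l • (f (a + l) - f a) = ∑ _k ∈ Finset.Ico a (a + l), (f (a + l) - f a) := by
        rw [Finset.sum_const, Nat.card_Ico, Nat.add_sub_cancel_left]
      _ < ∑ k ∈ Finset.Ico a (a + l), l • (f (k + 1) - f k) :=
        Finset.sum_lt_sum_of_nonempty (by simpa using hl) fun k hk =>
          hstep k (Finset.mem_Ico.1 hk)
      _ = l • (f (a + l) - f a) := by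
        rw [← Finset.smul_sum, Finset.sum_Ico_sub f (Nat.le_add_right a l)]
  exact hlt.false

variable {A : Type*} [TopologicalSpace A] {X : Subshift A ℤ}

theorem word_mem_language (x : Points X) (i : ℤ) (n : ℕ) : word x.1 i n ∈ language X n :=
  ⟨_, X.mapsTo i x.2, fun _ => rfl⟩

theorem image_init_language (X : Subshift A ℤ) (n : ℕ) :
    Fin.init '' language X (n + 1) = language X n := by
  ext w
  constructor
  · rintro ⟨u, ⟨x, hx, hxu⟩, rfl⟩
    exact ⟨x, hx, fun i => hxu i.castSucc⟩
  · rintro ⟨x, hx, hxw⟩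
    exact ⟨fun j => x (j : ℕ), ⟨x, hx, fun _ => rfl⟩, funext hxw⟩

theorem complexity_mono [Finite A] : Monotone (complexity X) :=
  monotone_nat_of_le_succ fun n => by
    rw [complexity, ← image_init_language]
    exact ncard_image_le

variable (X) in
/-- The words of length `k + 1` in the language of `X` whose prefix of length `k` is right
special. -/
def specialExtensions (k : ℕ) : Set (Fin (k + 1) → A) :=
  {w | ∃ x : Points X, RightSpecialBefore k x k ∧ word x.1 0 (k + 1) = w}

theorem ncard_specialExtensions_add_le [Finite A] (k : ℕ) :
    (specialExtensions X k).ncard + 2 * complexity X k ≤ 2 * complexity X (k + 1) := by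
  classical
  have hfin : (language X (k + 1)).Finite := toFinite _
  have himage : complexity X k = #(hfin.toFinset.image Fin.init) := by
    rw [complexity, ← image_init_language, ← ncard_coe_finset, Finset.coe_image, hfin.coe_toFinset]
  have hsubset : specialExtensions X k ⊆
      {u ∈ hfin.toFinset | ∃ v ∈ hfin.toFinset, v ≠ u ∧ Fin.init v = Fin.init u} := by
    rintro _ ⟨x, ⟨y, hyx, hne⟩, rfl⟩
    simp only [Finset.coe_filter, Finite.mem_toFinset, mem_ofPred_eq]
    refine ⟨word_mem_language x 0 _, _, word_mem_language y 0 _, fun h => hne ?_, ?_⟩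
    · exact word_eq_word_iff.1 h ⟨by omega, by push_cast; omega⟩
    · exact word_eq_word_iff.2 (by simpa using hyx)
  rw [himage, complexity, ncard_eq_toFinset_card _ hfin]
  refine le_trans (Nat.add_le_add_right ?_ _)
    (card_filter_exists_ne_add_le hfin.toFinset Fin.init)
  rw [← ncard_coe_finset]
  exact ncard_le_ncard hsubset (Finset.finite_toSet _)

section CountingAutomorphisms

variable [Finite A] [DiscreteTopology A] (hdense : HasDenseAperiodicPoints X)
include hdense

theorem eq_of_forall_specialExtensions_word_eq {r k : ℕ} (hr : 0 < r) (hrk : 4 * r ≤ k)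
    {z : specialExtensions X k → Points X} (hz : ∀ u, word (z u).1 0 (k + 1) = u)
    {φ ψ : Aut X} (hφ : φ ∈ autRange X r) (hψ : ψ ∈ autRange X r)
    (hφψ : ∀ u, word (φ.1 (z u)).1 r (k + 2 * r) = word (ψ.1 (z u)).1 r (k + 2 * r)) :
    φ = ψ := by
  refine (inv_mul_eq_one.1 ((hψ.2.mul hφ.1).eq_one_of_fixes_rightSpecial hdense
    (by omega) (by omega : 2 * (r + r) ≤ k) fun x hx => ?_)).symm
  set u : specialExtensions X k := ⟨word x.1 0 (k + 1), x, hx, rfl⟩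
  refine ⟨z u, fun j hj => word_eq_word_iff.1 (hz u) ⟨hj.1, ?_⟩, ?_⟩
  · have := hj.2
    push_cast
    omega
  · have hφψu := word_eq_word_iff.1 (hφψ u)
    have h : EqOn (ψ⁻¹.1 (φ.1 (z u))).1 (ψ⁻¹.1 (ψ.1 (z u))).1 (Ico (r + r : ℕ) (k + (r + r : ℕ))) :=
      hψ.2.eqOn_Ico (hφψu.mono (Ico_subset_Ico (by push_cast; omega) (by push_cast; omega)))
    rwa [show ψ⁻¹.1 (ψ.1 (z u)) = z u from ψ.1.symm_apply_apply (z u)] at h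

theorem exists_injective_autRange {r k : ℕ} (hr : 0 < r) (hrk : 4 * r ≤ k) :
    ∃ f : autRange X r → specialExtensions X k → language X (k + 2 * r),
      Function.Injective f := by
  choose z _ hz using fun u : specialExtensions X k => u.2
  refine ⟨fun φ u => ⟨_, word_mem_language (φ.1.1 (z u)) r _⟩, fun φ ψ hφψ => ?_⟩
  exact Subtype.ext <| eq_of_forall_specialExtensions_word_eq hdense hr hrk hz φ.2 ψ.2
    fun u => congrArg Subtype.val (congrFun hφψ u)

theorem finite_autRange (r : ℕ) : (autRange X r).Finite := by
  obtain ⟨f, hf⟩ := exists_injective_autRange hdense r.succ_pos le_rfl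
  exact (finite_coe_iff.1 (Finite.of_injective f hf)).subset (autRange_mono r.le_succ)

theorem ncard_autRange_le {r k : ℕ} (hr : 0 < r) (hrk : 4 * r ≤ k) :
    (autRange X r).ncard ≤ complexity X (k + 2 * r) ^ (specialExtensions X k).ncard := by
  obtain ⟨f, hf⟩ := exists_injective_autRange hdense hr hrk
  have hcard := Nat.card_le_card_of_injective f hf
  rwa [Nat.card_fun, Nat.card_coe_set_eq, Nat.card_coe_set_eq, Nat.card_coe_set_eq] at hcard

theorem mul_log_ncard_autRange_le {r : ℕ} (hr : 0 < r) :
    2 * r * Real.log (autRange X r).ncard ≤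
      complexity X (10 * r) * Real.log (complexity X (10 * r)) := by
  obtain ⟨k, ⟨hrk, hkr⟩, haverage⟩ := exists_mem_Ico_nsmul_sub_le
    (fun n => (complexity X n : ℤ)) (4 * r) (l := 4 * r) (by omega)
  set s := (specialExtensions X k).ncard
  have hspecial : 2 * r * s ≤ complexity X (10 * r) := by
    have hs : (s + 2 * complexity X k : ℤ) ≤ 2 * complexity X (k + 1) :=
      mod_cast ncard_specialExtensions_add_le k
    have hmono : (complexity X (4 * r + 4 * r) : ℤ) ≤ complexity X (10 * r) :=
      mod_cast complexity_mono (by omega)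
    rw [nsmul_eq_mul] at haverage
    push_cast at haverage
    zify
    nlinarith
  have hpos : 0 < (autRange X r).ncard :=
    (ncard_pos (finite_autRange hdense r)).2 ⟨1, one_mem_autRange r⟩
  have hcard : (autRange X r).ncard ≤ complexity X (10 * r) ^ s :=
    (ncard_autRange_le hdense hr hrk).trans
      (Nat.pow_le_pow_left (complexity_mono (by omega)) s)
  calc 2 * r * Real.log (autRange X r).ncard
      ≤ 2 * r * Real.log ((complexity X (10 * r) : ℝ) ^ s) := by
        gcongr
        exact_mod_cast hcard
    _ = (2 * r * s : ℕ) * Real.log (complexity X (10 * r)) := by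
        rw [Real.log_pow]
        push_cast
        ring
    _ ≤ complexity X (10 * r) * Real.log (complexity X (10 * r)) := by
        gcongr

theorem frequently_log_ncard_autRange_le
    (hcomplexity : ∀ ε : ℝ, 0 < ε → ∃ᶠ n : ℕ in atTop,
      complexity X n * Real.log (complexity X n) ≤ ε * n ^ 2) {ε : ℝ} (hε : 0 < ε) :
    ∃ᶠ r : ℕ in atTop, Real.log (autRange X r).ncard ≤ ε * r := by
  have hdiv : Tendsto (fun n : ℕ => n / 10) atTop atTop :=
    Nat.tendsto_div_const_atTop (by norm_num)
  refine hdiv.frequently (((hcomplexity (ε / 200) (by positivity)).and_eventually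
    (eventually_ge_atTop 10)).mono fun n ⟨hn, hn10⟩ => ?_)
  set r := n / 10
  have hr : 0 < r := by omega
  have hnr : (n : ℝ) ≤ 20 * r := by
    have : n ≤ 20 * r := by omega
    exact_mod_cast this
  have hmono : complexity X (10 * r) ≤ complexity X n := complexity_mono (by omega)
  have hr' : (0 : ℝ) < 2 * r := by positivity
  refine le_of_mul_le_mul_left ?_ hr'
  calc 2 * r * Real.log (autRange X r).ncard
      ≤ complexity X (10 * r) * Real.log (complexity X (10 * r)) :=
        mul_log_ncard_autRange_le hdense hr
    _ ≤ complexity X n * Real.log (complexity X n) := by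
        rcases (complexity X (10 * r)).eq_zero_or_pos with h | h
        · simpa [h] using mul_nonneg (Nat.cast_nonneg _) (Real.log_natCast_nonneg _)
        · gcongr
    _ ≤ ε / 200 * n ^ 2 := hn
    _ ≤ ε / 200 * (20 * r) ^ 2 := by gcongr
    _ = 2 * r * (ε * r) := by ring

end CountingAutomorphisms

end Counting

section Asymptotics

open Asymptotics Filter

theorem isBigO_log_natCast_of_eventually_le_pow {u : ℕ → ℕ} {d : ℕ}
    (hu : ∀ᶠ n in atTop, u n ≤ n ^ d) :
    (fun n => Real.log (u n)) =O[atTop] fun n : ℕ => Real.log n := by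
  refine IsBigO.of_bound d ?_
  filter_upwards [hu] with n hn
  rw [Real.norm_of_nonneg (Real.log_natCast_nonneg _),
    Real.norm_of_nonneg (Real.log_natCast_nonneg _), ← Real.log_pow]
  rcases (u n).eq_zero_or_pos with h | h
  · rw [h, Nat.cast_zero, Real.log_zero]
    exact_mod_cast Real.log_natCast_nonneg (n ^ d)
  · gcongr
    exact_mod_cast hn

theorem frequently_mul_log_le_of_isLittleO {u : ℕ → ℕ}
    (hu : (fun n => (u n : ℝ)) =o[atTop] fun n : ℕ => (n : ℝ) ^ 2 / Real.log n ^ 2) {ε : ℝ}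
    (hε : 0 < ε) : ∃ᶠ n : ℕ in atTop, u n * Real.log (u n) ≤ ε * n ^ 2 := by
  have hlog_ge : ∀ᶠ n : ℕ in atTop, 1 ≤ Real.log n :=
    (Real.tendsto_log_atTop.comp tendsto_natCast_atTop_atTop).eventually_ge_atTop 1
  have hle : ∀ᶠ n in atTop, u n ≤ n ^ 2 := by
    filter_upwards [hu.bound one_pos, hlog_ge] with n hn hlog
    rw [Real.norm_natCast, one_mul, Real.norm_of_nonneg (by positivity)] at hn
    exact_mod_cast hn.trans (div_le_self (by positivity) (one_le_pow₀ hlog))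
  have hmul : (fun n : ℕ => (n : ℝ) ^ 2 / Real.log n ^ 2 * Real.log n) =O[atTop]
      fun n : ℕ => (n : ℝ) ^ 2 := by
    refine IsBigO.of_bound 1 ?_
    filter_upwards [hlog_ge] with n hlog
    rw [one_mul, Real.norm_of_nonneg (by positivity), Real.norm_of_nonneg (by positivity)]
    calc (n : ℝ) ^ 2 / Real.log n ^ 2 * Real.log n = (n : ℝ) ^ 2 / Real.log n := by field_simp
      _ ≤ (n : ℝ) ^ 2 := div_le_self (by positivity) hlog
  have hlittle : (fun n => u n * Real.log (u n)) =o[atTop] fun n : ℕ => (n : ℝ) ^ 2 :=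
    (hu.mul_isBigO (isBigO_log_natCast_of_eventually_le_pow hle)).trans_isBigO hmul
  refine (hlittle.bound hε).frequently.mono fun n hn => ?_
  rw [Real.norm_of_nonneg (sq_nonneg (n : ℝ))] at hn
  exact (Real.le_norm_self _).trans hn

end Asymptotics

end SubshiftAut

open SubshiftAut Filter in
theorem theorem4p1_general {A : Type*} [Finite A] [TopologicalSpace A] [DiscreteTopology A]
    (X : SymbolicDynamics.FullShift.Subshift A ℤ) (hdense : HasDenseAperiodicPoints X)
    (hcomplexity : ∀ ε : ℝ, 0 < ε → ∃ᶠ n : ℕ in atTop,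
      complexity X n * Real.log (complexity X n) ≤ ε * n ^ 2) :
    IsAmenable (Aut X) := by
  have hfin (r : ℕ) : (autRange X r).Finite := finite_autRange hdense r
  refine isAmenable_of_frequently_log_card_le (B := fun r => (hfin r).toFinset)
    (fun r => ?_) (fun r s φ hφ ψ hψ => ?_) (fun φ => ?_) fun ε hε => ?_
  · exact (hfin r).mem_toFinset.2 (one_mem_autRange r)
  · rw [Set.Finite.mem_toFinset] at *
    exact mul_mem_autRange hφ hψ
  · simpa only [Set.Finite.mem_toFinset] using exists_mem_autRange φ
  · simpa only [← Set.ncard_eq_toFinset_card] using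
      frequently_log_ncard_autRange_le hdense hcomplexity hε

theorem theorem4p1 {A : Type*} [Finite A] [TopologicalSpace A] [DiscreteTopology A]
    (X : SymbolicDynamics.FullShift.Subshift A ℤ)
    (hdense : SubshiftAut.HasDenseAperiodicPoints X)
    (hcomplexity : (fun n : ℕ => (SubshiftAut.complexity X n : ℝ)) =o[Filter.atTop]
      fun n : ℕ => (n : ℝ) ^ 2 / Real.log n ^ 2) :
    SubshiftAut.IsAmenable (SubshiftAut.Aut X) :=
  theorem4p1_general X hdense fun _ hε =>
    SubshiftAut.frequently_mul_log_le_of_isLittleO hcomplexity hε
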